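/- Let $(\Omega,\mathcal F,\mathrm P)$ be a probability space that is standard and non-atomic, meaning here that there exists a random variable on it which is uniformly distributed on $(0,1)$. Let $V$ be the space of bounded random variables $X:\Omega\to\mathbb R$, and let $\rho:V\to\mathbb R\cup\{\infty\}$ be a risk measure which is not identically $\infty$. Call $\rho$ - coherent if for all $X,Y\in V$, $h>0$ and $a\in\mathbb R$: $X\le Y$ implies $\rho(X)\ge\rho(Y)$; $\rho(hX)=h\rho(X)$; $\rho(X+a)=\rho(X)-a$; and $\rho(X+Y)\le\rho(X)+\rho(Y)$; - law invariant if $\rho(X)=\rho(Y)$ whenever $X,Y\in V$ and $\mathrm P[X\le t]=\mathrm P[Y\le t]$ for all $t\in\mathbb R$; - comonotonic additive if $\rho(f\circ Z+g\circ Z)=\rho(f\circ Z)+\rho(g\circ Z)$ for all non-decreasing $f,g:\mathbb R\to\mathbb R$ and every real random variable $Z$ on $\Omega$ such that $f\circ Z,\,g\circ Z\in V$. For $u\in(0,1]$ let $\mathrm{VaR}_u(X)=\inf\{x\in\mathbb R:\mathrm P[-X\le x]\ge u\}$. Then $\rho$ is coherent, law invariant and comonotonic additive if and only if there are $p\in[0,1]$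 and a continuous distribution function $F$ on $\mathbb R$ which is concentrated on $[0,1]$ (that is, $F(u)=0$ for $u<0$ and $F(u)=1$ for $u\ge1$) and convex on $[0,1]$, such that $$\rho(X)=p\int_0^1\mathrm{VaR}_u(X)\,F(du)+(1-p)\,\mathrm{VaR}_1(X)\qquad\text{for all }X\in V.$$ -/

import Mathlib

open MeasureTheory

namespace RiskMeasure

/-- The space of bounded random variables: measurable functions `X : Ω → ℝ` bounded on `Ω`. -/
def boundedRV (Ω : Type*) [MeasurableSpace Ω] : Set (Ω → ℝ) :=
  {X | Measurable X ∧ ∃ C : ℝ, ∀ ω, |X ω| ≤ C}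

/-- The probability space carries a random variable that is uniformly distributed on `(0,1)`. -/
def IsStandardNonatomic {Ω : Type*} [MeasurableSpace Ω] (P : Measure Ω) : Prop :=
  ∃ U : Ω → ℝ, Measurable U ∧ pdf.IsUniform U (Set.Ioo (0 : ℝ) 1) P volume

/-- The `α`-quantile `inf {x ∈ ℝ : P[X ≤ x] ≥ α}`, with `inf ∅ = ∞`. -/
noncomputable def quantile {Ω : Type*} [MeasurableSpace Ω] (P : Measure Ω) (α : ℝ)
    (X : Ω → ℝ) : EReal :=
  sInf ((fun x : ℝ => (x : EReal)) '' {x : ℝ | α ≤ P.real {ω | X ω ≤ x}})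

/-- Value-at-risk at level `α`: `VaR_α(X) = q_α(-X)`. It is used for `α ∈ (0,1]` only; for these
`α` and bounded `X` it is a finite number. -/
noncomputable def VaR {Ω : Type*} [MeasurableSpace Ω] (P : Measure Ω) (α : ℝ)
    (X : Ω → ℝ) : EReal :=
  quantile P α (fun ω => -X ω)

/-! A risk measure on a set `V` of random variables is a map `ρ : V → ℝ ∪ {∞}`,
i.e. `ρ : V → WithTop ℝ`. -/

/-- `X ≤ Y` implies `ρ(X) ≥ ρ(Y)`. -/
def IsMonotonous {Ω : Type*} {V : Set (Ω → ℝ)} (ρ : V → WithTop ℝ) : Prop :=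
  ∀ X Y : V, (∀ ω, (X : Ω → ℝ) ω ≤ (Y : Ω → ℝ) ω) → ρ Y ≤ ρ X

/-- `ρ(hX) = h ρ(X)` for `h > 0`. -/
def IsPosHomogeneous {Ω : Type*} {V : Set (Ω → ℝ)} (ρ : V → WithTop ℝ) : Prop :=
  ∀ (X : V) (h : ℝ), 0 < h → ∀ hX : (fun ω => h * (X : Ω → ℝ) ω) ∈ V,
    ρ ⟨_, hX⟩ = (h : WithTop ℝ) * ρ X

/-- `ρ(X + a) = ρ(X) - a`. -/
def IsTranslationInvariant {Ω : Type*} {V : Set (Ω → ℝ)} (ρ : V → WithTop ℝ) : Prop :=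
  ∀ (X : V) (a : ℝ), ∀ hX : (fun ω => (X : Ω → ℝ) ω + a) ∈ V,
    ρ ⟨_, hX⟩ = ρ X + ((-a : ℝ) : WithTop ℝ)

/-- `ρ(X + Y) ≤ ρ(X) + ρ(Y)`. -/
def IsSubadditive {Ω : Type*} {V : Set (Ω → ℝ)} (ρ : V → WithTop ℝ) : Prop :=
  ∀ X Y : V, ∀ hXY : (fun ω => (X : Ω → ℝ) ω + (Y : Ω → ℝ) ω) ∈ V,
    ρ ⟨_, hXY⟩ ≤ ρ X + ρ Y

/-- Coherent risk measures. -/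
structure IsCoherent {Ω : Type*} {V : Set (Ω → ℝ)} (ρ : V → WithTop ℝ) : Prop where
  monotonous : IsMonotonous ρ
  posHomogeneous : IsPosHomogeneous ρ
  translationInvariant : IsTranslationInvariant ρ
  subadditive : IsSubadditive ρ

/-- `ρ(X) = ρ(Y)` whenever `P[X ≤ t] = P[Y ≤ t]` for all real `t`. -/
def IsLawInvariant {Ω : Type*} [MeasurableSpace Ω] (P : Measure Ω) {V : Set (Ω → ℝ)}
    (ρ : V → WithTop ℝ) : Prop :=
  ∀ X Y : V,
    (∀ t : ℝ, P {ω | (X : Ω → ℝ) ω ≤ t} = P {ω | (Y : Ω → ℝ) ω ≤ t}) → ρ X = ρ Y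

/-- `ρ(f ∘ Z + g ∘ Z) = ρ(f ∘ Z) + ρ(g ∘ Z)` for non-decreasing `f, g` and a real random
variable `Z`. -/
def IsComonotonicAdditive {Ω : Type*} [MeasurableSpace Ω] {V : Set (Ω → ℝ)}
    (ρ : V → WithTop ℝ) : Prop :=
  ∀ (f g : ℝ → ℝ) (Z : Ω → ℝ), Monotone f → Monotone g → Measurable Z →
    ∀ (hf : (fun ω => f (Z ω)) ∈ V) (hg : (fun ω => g (Z ω)) ∈ V)
      (hfg : (fun ω => f (Z ω) + g (Z ω)) ∈ V),
      ρ ⟨_, hfg⟩ = ρ ⟨_, hf⟩ + ρ ⟨_, hg⟩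

/-- `F` is a continuous distribution function on `ℝ` that is concentrated on `[0,1]` and convex
there. -/
structure IsContinuousConvexDF (F : StieltjesFunction ℝ) : Prop where
  continuous : Continuous F
  eq_zero : ∀ u < 0, F u = 0
  eq_one : ∀ u, 1 ≤ u → F u = 1
  convexOn : ConvexOn ℝ (Set.Icc 0 1) F

/-- `p ∫₀¹ VaR_u(X) F(du) + (1 - p) VaR₁(X)`; the integral is over `(0,1]`, and the point `0`
has no mass under a continuous `F`. -/
noncomputable def spectral {Ω : Type*} [MeasurableSpace Ω] (P : Measure Ω) (p : ℝ)
    (F : StieltjesFunction ℝ) (X : Ω → ℝ) : ℝ :=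
  p * (∫ u in (0 : ℝ)..1, (VaR P u X).toReal ∂F.measure) + (1 - p) * (VaR P 1 X).toReal

end RiskMeasure

/-!
The common ground of both directions is a functional `r` on bounded random variables that is
monotone, positively homogeneous, translation invariant and comonotonic additive
(`IsComonotoneFunctional`), together with its set function `c(A) = r(-1_A)`.

* For an integer-valued loss `N` the level sets `{k < N}` are nested, so comonotonic additivity
  gives the layer-cake formula `r(-N) = ∑ₖ c{k < N}` (`map_neg_natCast`). Rounding the losses to
  multiples of a small `ε` shows that `r` is determined by `c` (`eq_of_eq_on_events`).
* `r` is subadditive iff `c` is submodular. For the nontrivial implication (`subadditive`) one adds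
  one indicator `1_A` at a time to an integer loss; submodularity bounds each layer, and the bounds
  telescope to `c(A)`. For the converse, `1_{A ∪ B}` and `1_{A ∩ B}` are comonotone with sum
  `1_A + 1_B`.

A spectral functional is such an `r`, because the quantile is the lower adjoint of the distribution
function and hence is itself comonotonic additive. Its set function is
`p (1 - F(1 - P(A))) + (1 - p) 1_{P(A) > 0}`, and it is submodular because `F` is convex. So
spectral functionals are coherent, with no integral representation of average value-at-risk involved.

Conversely, law invariance makes `c(A) = ψ(P(A))`. On a non-atomic space submodularity is midpoint
concavity of `ψ`, and a bounded midpoint convex function is convex (`convexOn_of_midpoint_of_le`).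
So `G(u) = 1 - ψ(1 - u)` is convex, hence continuous except for a jump at `1`. With `p` its left limit
there, `F = G / p` on `[0, 1)` gives a spectral functional with the set function `c`, and the two
functionals agree (`exists_spectral`).
-/

namespace RiskMeasure

/-! ### Comonotonic additive functionals on bounded random variables -/

section Functional

variable {Ω : Type*} [MeasurableSpace Ω]

lemma const_mem_boundedRV (a : ℝ) : (fun _ : Ω => a) ∈ boundedRV Ω :=
  ⟨measurable_const, |a|, fun _ => le_rfl⟩

lemma add_mem_boundedRV {X Y : Ω → ℝ} (hX : X ∈ boundedRV Ω) (hY : Y ∈ boundedRV Ω) :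
    (fun ω => X ω + Y ω) ∈ boundedRV Ω := by
  obtain ⟨hXm, C, hC⟩ := hX
  obtain ⟨hYm, D, hD⟩ := hY
  exact ⟨hXm.add hYm, C + D, fun ω => (abs_add_le _ _).trans (add_le_add (hC ω) (hD ω))⟩

lemma const_mul_mem_boundedRV {X : Ω → ℝ} (hX : X ∈ boundedRV Ω) (h : ℝ) :
    (fun ω => h * X ω) ∈ boundedRV Ω := by
  obtain ⟨hXm, C, hC⟩ := hX
  exact ⟨hXm.const_mul h, |h| * C, fun ω => by
    rw [abs_mul]; exact mul_le_mul_of_nonneg_left (hC ω) (abs_nonneg h)⟩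

lemma add_const_mem_boundedRV {X : Ω → ℝ} (hX : X ∈ boundedRV Ω) (a : ℝ) :
    (fun ω => X ω + a) ∈ boundedRV Ω :=
  add_mem_boundedRV hX (const_mem_boundedRV a)

lemma neg_mem_boundedRV {X : Ω → ℝ} (hX : X ∈ boundedRV Ω) : (fun ω => -X ω) ∈ boundedRV Ω :=
  ⟨hX.1.neg, hX.2.imp fun _ hC ω => by rw [abs_neg]; exact hC ω⟩

/-- The position that loses one unit on `A` and nothing elsewhere, `-1_A`. -/
noncomputable def unitLoss (A : Set Ω) : Ω → ℝ := A.indicator fun _ => -1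

lemma unitLoss_mem_boundedRV {A : Set Ω} (hA : MeasurableSet A) : unitLoss A ∈ boundedRV Ω := by
  refine ⟨measurable_const.indicator hA, 1, fun ω => ?_⟩
  by_cases h : ω ∈ A <;> simp [unitLoss, h]

lemma neg_natCast_mem_boundedRV {N : Ω → ℕ} (hN : Measurable N) {n : ℕ} (hn : ∀ ω, N ω ≤ n) :
    (fun ω => -(N ω : ℝ)) ∈ boundedRV Ω := by
  refine ⟨(measurable_from_top.comp hN).neg, n, fun ω => ?_⟩
  rw [abs_neg, Nat.abs_cast]
  exact_mod_cast hn ω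

/-- The properties shared by the finite coherent comonotonic additive risk measures and the spectral
functionals, with subadditivity left out. The functional is total; only its values on `boundedRV Ω`
matter. -/
structure IsComonotoneFunctional (r : (Ω → ℝ) → ℝ) : Prop where
  mono : ∀ X ∈ boundedRV Ω, ∀ Y ∈ boundedRV Ω, (∀ ω, X ω ≤ Y ω) → r Y ≤ r X
  hom : ∀ X ∈ boundedRV Ω, ∀ h : ℝ, 0 < h → r (fun ω => h * X ω) = h * r X
  trans : ∀ X ∈ boundedRV Ω, ∀ a : ℝ, r (fun ω => X ω + a) = r X - a
  comon : ∀ (f g : ℝ → ℝ) (Z : Ω → ℝ), Monotone f → Monotone g → Measurable Z →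
    (fun ω => f (Z ω)) ∈ boundedRV Ω → (fun ω => g (Z ω)) ∈ boundedRV Ω →
      r (fun ω => f (Z ω) + g (Z ω)) = r (fun ω => f (Z ω)) + r (fun ω => g (Z ω))

/-- The set function `A ↦ r(-1_A)` is submodular. -/
def IsSubmodularOnEvents (r : (Ω → ℝ) → ℝ) : Prop :=
  ∀ A B : Set Ω, MeasurableSet A → MeasurableSet B →
    r (unitLoss (A ∪ B)) + r (unitLoss (A ∩ B)) ≤ r (unitLoss A) + r (unitLoss B)

namespace IsComonotoneFunctional

variable {r : (Ω → ℝ) → ℝ}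

lemma map_zero (hr : IsComonotoneFunctional r) : r (fun _ => 0) = 0 := by
  have h := hr.hom _ (const_mem_boundedRV 0) 2 two_pos
  simp only [mul_zero] at h
  linarith

lemma unitLoss_empty (hr : IsComonotoneFunctional r) : r (unitLoss (∅ : Set Ω)) = 0 := by
  simpa [unitLoss] using hr.map_zero

lemma unitLoss_univ (hr : IsComonotoneFunctional r) : r (unitLoss (Set.univ : Set Ω)) = 1 := by
  have h := hr.trans _ (const_mem_boundedRV 0) (-1)
  rw [hr.map_zero] at h
  simpa [unitLoss] using h

lemma unitLoss_mono (hr : IsComonotoneFunctional r) {A B : Set Ω} (hA : MeasurableSet A)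
    (hB : MeasurableSet B) (h : A ⊆ B) :
    r (unitLoss A) ≤ r (unitLoss B) := by
  refine hr.mono _ (unitLoss_mem_boundedRV hB) _ (unitLoss_mem_boundedRV hA) fun ω => ?_
  by_cases h1 : ω ∈ A
  · simp [unitLoss, h1, h h1]
  · by_cases h2 : ω ∈ B <;> simp [unitLoss, h1, h2]

/-- Layer-cake formula for integer losses: the level sets `{k < N}` are nested, so their
indicators are monotone functions of one variable and comonotonic additivity applies. -/
lemma map_neg_natCast (hr : IsComonotoneFunctional r) {N : Ω → ℕ} (hN : Measurable N) {n : ℕ}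
    (hn : ∀ ω, N ω ≤ n) :
    r (fun ω => -(N ω : ℝ)) = ∑ k ∈ Finset.range n, r (unitLoss {ω | k < N ω}) := by
  have hlt : ∀ k : ℕ, MeasurableSet {ω | k < N ω} := fun k => hN measurableSet_Ioi
  have key : ∀ m : ℕ, r (fun ω => -((min (N ω) m : ℕ) : ℝ)) =
      ∑ k ∈ Finset.range m, r (unitLoss {ω | k < N ω}) := by
    intro m
    induction m with
    | zero => simpa using hr.map_zero
    | succ m ih =>
      rw [Finset.sum_range_succ, ← ih]
      have e1 : (fun ω => -((min (N ω) m : ℕ) : ℝ)) = fun ω => max (-(N ω : ℝ)) (-(m : ℝ)) := by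
        funext ω
        rw [max_neg_neg, Nat.cast_min]
      have e2 : unitLoss {ω | m < N ω} =
          fun ω => (fun z : ℝ => if z < -(m : ℝ) then (-1 : ℝ) else 0) (-(N ω : ℝ)) := by
        funext ω
        simp [unitLoss, Set.indicator_apply]
      have e3 : (fun ω => -((min (N ω) (m + 1) : ℕ) : ℝ)) = fun ω =>
          max (-(N ω : ℝ)) (-(m : ℝ)) +
            (fun z : ℝ => if z < -(m : ℝ) then (-1 : ℝ) else 0) (-(N ω : ℝ)) := by
        funext ω
        rw [max_neg_neg, ← Nat.cast_min]
        simp only [neg_lt_neg_iff, Nat.cast_lt]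
        split_ifs with h
        · rw [min_eq_right (by omega), min_eq_right (by omega)]; push_cast; ring
        · rw [min_eq_left (by omega), min_eq_left (by omega)]; ring
      have hmin := neg_natCast_mem_boundedRV (hN.min measurable_const) (n := m)
        fun ω => min_le_right (N ω) m
      have hset := unitLoss_mem_boundedRV (hlt m)
      rw [e3]
      rw [e1] at hmin ⊢
      rw [e2] at hset ⊢
      refine hr.comon (fun z => max z (-(m : ℝ))) (fun z => if z < -(m : ℝ) then (-1 : ℝ) else 0)
        (fun ω => -(N ω : ℝ)) (fun a b h => max_le_max h le_rfl) ?_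
        (measurable_from_top.comp hN).neg hmin hset
      intro a b h
      dsimp only
      split_ifs with h1 h2 <;> linarith
  simpa only [min_eq_left (hn _)] using key n

/-- `⌊(C - X) / ε⌋` for a bounded random variable `X ≤ C`: the losses `C - X` measured in multiples
of `ε`. -/
lemma exists_discretization {X : Ω → ℝ} (hX : X ∈ boundedRV Ω) {C : ℝ} (hC : ∀ ω, |X ω| ≤ C)
    {ε : ℝ} (hε : 0 < ε) :
    ∃ (N : Ω → ℕ) (n : ℕ), Measurable N ∧ (∀ ω, N ω ≤ n) ∧
      ∀ ω, X ω ≤ ε * -(N ω : ℝ) + C ∧ ε * -(N ω : ℝ) + (C - ε) ≤ X ω := by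
  refine ⟨fun ω => ⌊(C - X ω) / ε⌋₊, ⌊(2 * C) / ε⌋₊,
    Nat.measurable_floor.comp ((measurable_const.sub hX.1).div_const ε), fun ω => ?_, fun ω => ?_⟩
  · have := abs_le.1 (hC ω)
    exact Nat.floor_le_floor (by gcongr; linarith)
  · have := abs_le.1 (hC ω)
    have h1 := Nat.floor_le (a := (C - X ω) / ε) (div_nonneg (by linarith) hε.le)
    have h2 := Nat.lt_floor_add_one ((C - X ω) / ε)
    rw [le_div_iff₀ hε] at h1
    rw [div_lt_iff₀ hε] at h2
    constructor <;> nlinarith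

lemma map_affine (hr : IsComonotoneFunctional r) {X : Ω → ℝ} (hX : X ∈ boundedRV Ω) {ε : ℝ}
    (hε : 0 < ε) (a : ℝ) :
    r (fun ω => ε * X ω + a) = ε * r X - a := by
  rw [hr.trans _ (const_mul_mem_boundedRV hX ε), hr.hom _ hX _ hε]

/-- Sandwich between staircases; the two bounds differ by `ε`. -/
lemma map_mem_Icc (hr : IsComonotoneFunctional r) {X : Ω → ℝ} (hX : X ∈ boundedRV Ω) {Y : Ω → ℝ}
    (hY : Y ∈ boundedRV Ω) {ε C : ℝ}
    (hε : 0 < ε) (h : ∀ ω, X ω ≤ ε * Y ω + C ∧ ε * Y ω + (C - ε) ≤ X ω) :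
    ε * r Y - C ≤ r X ∧ r X ≤ ε * r Y - C + ε := by
  have h1 := hr.mono _ hX _ (add_const_mem_boundedRV (const_mul_mem_boundedRV hY ε) C) fun ω =>
    (h ω).1
  have h2 := hr.mono _ (add_const_mem_boundedRV (const_mul_mem_boundedRV hY ε) (C - ε)) _ hX fun ω
    => (h ω).2
  rw [hr.map_affine hY hε] at h1 h2
  constructor <;> linarith

/-- A comonotone functional is determined by its values on the positions `-1_A`. -/
theorem eq_of_eq_on_events (hr : IsComonotoneFunctional r) {s : (Ω → ℝ) → ℝ}
    (hs : IsComonotoneFunctional s)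
    (h : ∀ A, MeasurableSet A → r (unitLoss A) = s (unitLoss A)) {X : Ω → ℝ}
    (hX : X ∈ boundedRV Ω) : r X = s X := by
  obtain ⟨C, hC⟩ := hX.2
  have hle : ∀ ε > 0, |r X - s X| ≤ ε := by
    intro ε hε
    obtain ⟨N, n, hN, hn, hXN⟩ := exists_discretization hX hC hε
    have hr' := hr.map_mem_Icc hX (neg_natCast_mem_boundedRV hN hn) hε hXN
    have hs' := hs.map_mem_Icc hX (neg_natCast_mem_boundedRV hN hn) hε hXN
    have e : r (fun ω => -(N ω : ℝ)) = s (fun ω => -(N ω : ℝ)) := by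
      rw [hr.map_neg_natCast hN hn, hs.map_neg_natCast hN hn]
      exact Finset.sum_congr rfl fun k _ => h _ (hN measurableSet_Ioi)
    rw [e] at hr'
    rw [abs_le]
    constructor <;> linarith [hr'.1, hr'.2, hs'.1, hs'.2]
  have h0 : |r X - s X| ≤ 0 := le_of_forall_pos_le_add fun ε hε => by simpa using hle ε hε
  exact sub_eq_zero.1 (abs_nonpos_iff.1 h0)

/-- Increasing an integer loss by `1_A` raises each level set `{k < N}` to
`{k < N} ∪ (A ∩ {k ≤ N})`; submodularity bounds the increments by a telescoping sum. -/
lemma map_add_indicator_le (hr : IsComonotoneFunctional r) (hsub : IsSubmodularOnEvents r)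
    {N : Ω → ℕ} (hN : Measurable N)
    {n : ℕ} (hn : ∀ ω, N ω ≤ n) {A : Set Ω} (hA : MeasurableSet A) :
    r (fun ω => -((N ω + A.indicator (fun _ => 1) ω : ℕ) : ℝ)) ≤
      r (fun ω => -(N ω : ℝ)) + r (unitLoss A) := by
  classical
  have hlt : ∀ k : ℕ, MeasurableSet {ω | k < N ω} := fun k => hN measurableSet_Ioi
  have hAle : ∀ k : ℕ, MeasurableSet (A ∩ {ω | k ≤ N ω}) := fun k =>
    hA.inter (hN measurableSet_Ici)
  have hind : Measurable (A.indicator fun _ => (1 : ℕ)) := measurable_const.indicator hA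
  have hM : ∀ ω, N ω + A.indicator (fun _ => 1) ω ≤ n + 1 := fun ω =>
    add_le_add (hn ω) (by rw [Set.indicator_apply]; split_ifs <;> omega)
  rw [hr.map_neg_natCast (N := fun ω => N ω + A.indicator (fun _ => 1) ω) (hN.add hind) hM,
    hr.map_neg_natCast hN (n := n + 1) fun ω => (hn ω).trans n.le_succ]
  have hstep : ∀ k ∈ Finset.range (n + 1),
      r (unitLoss {ω | k < N ω + A.indicator (fun _ => 1) ω}) ≤
        r (unitLoss {ω | k < N ω}) + (r (unitLoss (A ∩ {ω | k ≤ N ω})) -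
          r (unitLoss (A ∩ {ω | k + 1 ≤ N ω}))) := by
    intro k _
    have h := hsub _ _ (hlt k) (hAle k)
    have e1 : {ω | k < N ω} ∪ A ∩ {ω | k ≤ N ω} =
        {ω | k < N ω + A.indicator (fun _ => 1) ω} := by
      ext ω
      by_cases hω : ω ∈ A
      · simp [hω]; omega
      · simp [hω]
    have e2 : {ω | k < N ω} ∩ (A ∩ {ω | k ≤ N ω}) = A ∩ {ω | k + 1 ≤ N ω} := by
      ext ω
      simp only [Set.mem_inter_iff, Set.mem_ofPred_eq]
      constructor
      · rintro ⟨h1, h2, -⟩; exact ⟨h2, h1⟩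
      · rintro ⟨h1, h2⟩; exact ⟨h2, h1, by omega⟩
    rw [e1, e2] at h
    linarith
  refine (Finset.sum_le_sum hstep).trans ?_
  rw [Finset.sum_add_distrib,
    Finset.sum_range_sub' (fun k => r (unitLoss (A ∩ {ω | k ≤ N ω})))]
  have e0 : A ∩ {ω | 0 ≤ N ω} = A := by ext; simp
  have e1 : A ∩ {ω | n + 1 ≤ N ω} = ∅ := by
    ext ω
    simp only [Set.mem_inter_iff, Set.mem_ofPred_eq, Set.mem_empty_iff_false, iff_false, not_and]
    intro _
    have := hn ω
    omega
  rw [e0, e1, hr.unitLoss_empty, sub_zero]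

lemma map_natCast_add_le (hr : IsComonotoneFunctional r) (hsub : IsSubmodularOnEvents r)
    {N M : Ω → ℕ} (hN : Measurable N)
    (hM : Measurable M) {n m : ℕ} (hn : ∀ ω, N ω ≤ n) (hm : ∀ ω, M ω ≤ m) :
    r (fun ω => -((N ω + M ω : ℕ) : ℝ)) ≤ r (fun ω => -(N ω : ℝ)) + r (fun ω => -(M ω : ℝ)) := by
  classical
  rw [hr.map_neg_natCast hM hm]
  have key : ∀ j : ℕ, r (fun ω => -((N ω + min (M ω) j : ℕ) : ℝ)) ≤
      r (fun ω => -(N ω : ℝ)) + ∑ k ∈ Finset.range j, r (unitLoss {ω | k < M ω}) := by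
    intro j
    induction j with
    | zero => simp
    | succ j ih =>
      have h := hr.map_add_indicator_le hsub (hN.add (hM.min measurable_const)) (n := n + j)
        (fun ω => add_le_add (hn ω) (min_le_right (M ω) j)) (A := {ω | j < M ω})
        (hM measurableSet_Ioi)
      have e : (fun ω => -((N ω + min (M ω) (j + 1) : ℕ) : ℝ)) = fun ω => -(((N ω + min (M ω) j) +
          {ω | j < M ω}.indicator (fun _ => 1) ω : ℕ) : ℝ) := by
        funext ω
        by_cases hω : j < M ω
        · rw [Set.indicator_of_mem (by exact hω)]; congr 2; omega
        · rw [Set.indicator_of_notMem (by exact hω)]; congr 2; omega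
      rw [e, Finset.sum_range_succ]
      simp only [Pi.add_apply] at h
      linarith
  simpa only [min_eq_left (hm _)] using key m

/-- A comonotone functional whose set function is submodular is subadditive. -/
theorem subadditive (hr : IsComonotoneFunctional r) (hsub : IsSubmodularOnEvents r) {X Y : Ω → ℝ}
    (hX : X ∈ boundedRV Ω)
    (hY : Y ∈ boundedRV Ω) : r (fun ω => X ω + Y ω) ≤ r X + r Y := by
  obtain ⟨C, hC⟩ := hX.2
  obtain ⟨D, hD⟩ := hY.2
  refine le_of_forall_pos_le_add fun δ hδ => ?_
  have hε : 0 < δ / 2 := half_pos hδ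
  set ε := δ / 2 with hεdef
  obtain ⟨N, n, hN, hn, hXN⟩ := exists_discretization hX hC hε
  obtain ⟨M, m, hM, hm, hYM⟩ := exists_discretization hY hD hε
  have hNM : (fun ω => -((N ω + M ω : ℕ) : ℝ)) ∈ boundedRV Ω :=
    neg_natCast_mem_boundedRV (hN.add hM) (n := n + m) fun ω => add_le_add (hn ω) (hm ω)
  have h1 := (hr.map_mem_Icc hX (neg_natCast_mem_boundedRV hN hn) hε hXN).1
  have h2 := (hr.map_mem_Icc hY (neg_natCast_mem_boundedRV hM hm) hε hYM).1
  have h3 := hr.mono _ (add_const_mem_boundedRV (const_mul_mem_boundedRV hNM ε) (C + D - 2 * ε)) _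
    (add_mem_boundedRV hX hY) fun ω => by
    have hx := (hXN ω).2
    have hy := (hYM ω).2
    push_cast
    linarith
  rw [hr.map_affine hNM hε] at h3
  have h4 := mul_le_mul_of_nonneg_left (hr.map_natCast_add_le hsub hN hM hn hm) hε.le
  linarith

end IsComonotoneFunctional

end Functional

/-! ### Quantiles of bounded random variables -/

section Quantile

variable {Ω : Type*} [MeasurableSpace Ω] {P : Measure Ω} [IsProbabilityMeasure P]

/-- The quantile is the lower adjoint of the distribution function. The infimum in its definition
is attained because distribution functions are right-continuous. -/
lemma quantile_toReal_le_iff {Y : Ω → ℝ} (hY : Y ∈ boundedRV Ω) {u : ℝ} (hu : u ∈ Set.Ioc (0 : ℝ) 1)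
    (x : ℝ) : (quantile P u Y).toReal ≤ x ↔ u ≤ P.real {ω | Y ω ≤ x} := by
  obtain ⟨hYm, C, hC⟩ := hY
  have : IsProbabilityMeasure (P.map Y) := Measure.isProbabilityMeasure_map hYm.aemeasurable
  have hcdf : ∀ x, P.real {ω | Y ω ≤ x} = ProbabilityTheory.cdf (P.map Y) x := fun x => by
    rw [ProbabilityTheory.cdf_eq_real, map_measureReal_apply hYm measurableSet_Iic]
    rfl
  set S : Set ℝ := {x : ℝ | u ≤ P.real {ω | Y ω ≤ x}} with hS
  have hne : C ∈ S := by
    have h : {ω | Y ω ≤ C} = Set.univ := Set.eq_univ_of_forall fun ω => (abs_le.1 (hC ω)).2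
    simp only [hS, Set.mem_ofPred_eq, h, probReal_univ]
    exact hu.2
  have hbdd : BddBelow S := by
    refine ⟨-C, fun x hx => ?_⟩
    by_contra hlt
    have h : {ω | Y ω ≤ x} = ∅ := Set.eq_empty_of_forall_notMem fun ω hω =>
      hlt ((abs_le.1 (hC ω)).1.trans hω)
    simp only [hS, Set.mem_ofPred_eq, h, measureReal_empty] at hx
    exact absurd hx (not_le.2 hu.1)
  have hgt : ∀ x, sInf S < x → x ∈ S := by
    intro x hx
    obtain ⟨y, hy, hyx⟩ := exists_lt_of_csInf_lt ⟨C, hne⟩ hx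
    exact le_trans (show u ≤ P.real {ω | Y ω ≤ y} from hy)
      (measureReal_mono fun ω (hω : Y ω ≤ y) => hω.trans hyx.le)
  have hmem : sInf S ∈ S := by
    simp only [hS, Set.mem_ofPred_eq]
    rw [hcdf]
    have ht := ((ProbabilityTheory.cdf (P.map Y)).right_continuous (sInf S)).mono
      Set.Ioi_subset_Ici_self
    refine ge_of_tendsto ht ?_
    filter_upwards [self_mem_nhdsWithin] with x hx
    rw [← hcdf]
    exact hgt x hx
  have hq : quantile P u Y = (sInf S : ℝ) := by
    refine IsLeast.csInf_eq ⟨⟨_, hmem, rfl⟩, ?_⟩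
    rintro _ ⟨x, hx, rfl⟩
    exact EReal.coe_le_coe_iff.2 (csInf_le hbdd hx)
  rw [hq, EReal.toReal_coe]
  refine ⟨fun h => ?_, fun h => csInf_le hbdd h⟩
  rcases h.eq_or_lt with h | h
  · rw [← h]; exact hmem
  · exact hgt x h

variable (P) in
/-- Value-at-risk as a real number. -/
noncomputable def realVaR (u : ℝ) (X : Ω → ℝ) : ℝ := (VaR P u X).toReal

lemma realVaR_le_iff {X : Ω → ℝ} (hX : X ∈ boundedRV Ω) {u : ℝ} (hu : u ∈ Set.Ioc (0 : ℝ) 1)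
    (x : ℝ) : realVaR P u X ≤ x ↔ u ≤ P.real {ω | -X ω ≤ x} :=
  quantile_toReal_le_iff (neg_mem_boundedRV hX) hu x

lemma realVaR_anti {X Y : Ω → ℝ} (hX : X ∈ boundedRV Ω) (hY : Y ∈ boundedRV Ω)
    (h : ∀ ω, X ω ≤ Y ω) {u : ℝ} (hu : u ∈ Set.Ioc (0 : ℝ) 1) : realVaR P u Y ≤ realVaR P u X := by
  rw [realVaR_le_iff hY hu]
  refine ((realVaR_le_iff hX hu _).1 le_rfl).trans (measureReal_mono fun ω hω => ?_)
  exact (neg_le_neg (h ω)).trans hω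

lemma realVaR_mono_level {X : Ω → ℝ} (hX : X ∈ boundedRV Ω) :
    MonotoneOn (fun u => realVaR P u X) (Set.Ioc 0 1) := fun _ hu _ hv huv =>
  (realVaR_le_iff hX hu _).2 (huv.trans ((realVaR_le_iff hX hv _).1 le_rfl))

lemma realVaR_const_mul {X : Ω → ℝ} (hX : X ∈ boundedRV Ω) {h : ℝ} (hh : 0 < h) {u : ℝ}
    (hu : u ∈ Set.Ioc (0 : ℝ) 1) : realVaR P u (fun ω => h * X ω) = h * realVaR P u X := by
  refine eq_of_forall_ge_iff fun x => ?_
  rw [realVaR_le_iff (const_mul_mem_boundedRV hX h) hu, mul_comm, ← le_div_iff₀ hh, realVaR_le_iff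
    hX hu]
  have e : {ω | -(h * X ω) ≤ x} = {ω | -X ω ≤ x / h} := by
    ext ω
    simp only [Set.mem_ofPred_eq]
    rw [le_div_iff₀ hh, neg_mul, mul_comm]
  rw [e]

lemma realVaR_add_const {X : Ω → ℝ} (hX : X ∈ boundedRV Ω) (a : ℝ) {u : ℝ}
    (hu : u ∈ Set.Ioc (0 : ℝ) 1) : realVaR P u (fun ω => X ω + a) = realVaR P u X - a := by
  refine eq_of_forall_ge_iff fun x => ?_
  rw [realVaR_le_iff (add_const_mem_boundedRV hX a) hu, sub_le_iff_le_add, realVaR_le_iff hX hu]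
  have e : {ω | -(X ω + a) ≤ x} = {ω | -X ω ≤ x + a} := by
    ext ω
    simp only [Set.mem_ofPred_eq]
    constructor <;> intro h <;> linarith
  rw [e]

/-- Level sets of two monotone functions of the same variable are nested. -/
lemma levelSets_nested {α : Type*} {f g : ℝ → ℝ} (hf : Monotone f) (hg : Monotone g) (Z : α → ℝ)
    (a b : ℝ) : {ω | -f (Z ω) ≤ a} ⊆ {ω | -g (Z ω) ≤ b} ∨
      {ω | -g (Z ω) ≤ b} ⊆ {ω | -f (Z ω) ≤ a} := by
  by_contra! hcon
  obtain ⟨ω, h1, h2⟩ := Set.not_subset.1 hcon.1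
  obtain ⟨η, h3, h4⟩ := Set.not_subset.1 hcon.2
  simp only [Set.mem_ofPred_eq, not_le] at h1 h2 h3 h4
  rcases le_total (Z ω) (Z η) with h | h
  · linarith [hf h]
  · linarith [hg h]

lemma realVaR_comonotone_add {f g : ℝ → ℝ} (hf : Monotone f) (hg : Monotone g) {Z : Ω → ℝ}
    (hfZ : (fun ω => f (Z ω)) ∈ boundedRV Ω) (hgZ : (fun ω => g (Z ω)) ∈ boundedRV Ω) {u : ℝ}
    (hu : u ∈ Set.Ioc (0 : ℝ) 1) :
    realVaR P u (fun ω => f (Z ω) + g (Z ω)) =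
      realVaR P u (fun ω => f (Z ω)) + realVaR P u (fun ω => g (Z ω)) := by
  have hfg := add_mem_boundedRV hfZ hgZ
  apply le_antisymm
  · have h1 := (realVaR_le_iff (P := P) hfZ hu _).1 le_rfl
    have h2 := (realVaR_le_iff (P := P) hgZ hu _).1 le_rfl
    rw [realVaR_le_iff hfg hu]
    rcases levelSets_nested hf hg Z (realVaR P u fun ω => f (Z ω)) (realVaR P u fun ω => g (Z ω))
      with h | h
    · refine h1.trans (measureReal_mono fun ω hω => ?_)
      have h' := h hω
      simp only [Set.mem_ofPred_eq] at hω h' ⊢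
      linarith
    · refine h2.trans (measureReal_mono fun ω hω => ?_)
      have h' := h hω
      simp only [Set.mem_ofPred_eq] at hω h' ⊢
      linarith
  · -- If the sum of the two quantiles were larger, there would be `a`, `b` strictly below them
    -- such that the quantile of the sum is at most `a + b`; but `{-f(Z) - g(Z) ≤ a + b}` is
    -- contained in the larger of two nested events of probability less than `u`.
    by_contra! hlt
    set qf := realVaR P u fun ω => f (Z ω)
    set qg := realVaR P u fun ω => g (Z ω)
    set q := realVaR P u fun ω => f (Z ω) + g (Z ω)
    set δ := (qf + qg - q) / 2 with hδ
    have hδ0 : 0 < δ := by linarith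
    have h1 : ¬ qf ≤ qf - δ := by linarith
    have h2 : ¬ qg ≤ qg - δ := by linarith
    rw [realVaR_le_iff hfZ hu] at h1
    rw [realVaR_le_iff hgZ hu] at h2
    have h3 : q ≤ (qf - δ) + (qg - δ) := by linarith
    rw [realVaR_le_iff hfg hu] at h3
    have hsub : {ω | -(f (Z ω) + g (Z ω)) ≤ (qf - δ) + (qg - δ)} ⊆
        {ω | -f (Z ω) ≤ qf - δ} ∪ {ω | -g (Z ω) ≤ qg - δ} := by
      intro ω hω
      by_contra hn
      simp only [Set.mem_union, Set.mem_ofPred_eq, not_or, not_le] at hn hω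
      linarith [hn.1, hn.2]
    have h4 := h3.trans (measureReal_mono hsub)
    rcases levelSets_nested hf hg Z (qf - δ) (qg - δ) with h | h
    · rw [Set.union_eq_self_of_subset_left h] at h4; exact h2 h4
    · rw [Set.union_eq_self_of_subset_right h] at h4; exact h1 h4

lemma realVaR_congr_law {X Y : Ω → ℝ} (hX : Measurable X) (hY : Measurable Y)
    (h : ∀ t : ℝ, P {ω | X ω ≤ t} = P {ω | Y ω ≤ t}) (u : ℝ) : realVaR P u X = realVaR P u Y := by
  have hmap : P.map X = P.map Y := by
    have := Measure.isProbabilityMeasure_map (μ := P) hX.aemeasurable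
    refine Measure.ext_of_Iic _ _ fun t => ?_
    rw [Measure.map_apply hX measurableSet_Iic, Measure.map_apply hY measurableSet_Iic]
    exact h t
  have e : ∀ x : ℝ, P.real {ω | -X ω ≤ x} = P.real {ω | -Y ω ≤ x} := by
    intro x
    have hs : ∀ W : Ω → ℝ, {ω | -W ω ≤ x} = W ⁻¹' Set.Ici (-x) := fun W => by
      ext ω
      simp [neg_le]
    rw [hs, hs, ← map_measureReal_apply hX measurableSet_Ici,
      ← map_measureReal_apply hY measurableSet_Ici, hmap]
  simp only [realVaR, VaR, quantile, e]

lemma realVaR_unitLoss {A : Set Ω} (hA : MeasurableSet A) {u : ℝ} (hu : u ∈ Set.Ioc (0 : ℝ) 1) :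
    realVaR P u (unitLoss A) = (Set.Ioi (1 - P.real A)).indicator (fun _ => 1) u := by
  refine eq_of_forall_ge_iff fun x => ?_
  rw [realVaR_le_iff (unitLoss_mem_boundedRV hA) hu]
  have hval : ∀ ω, -unitLoss A ω = A.indicator (fun _ => 1) ω := fun ω => by
    by_cases h : ω ∈ A <;> simp [unitLoss, h]
  simp only [hval]
  rcases lt_or_ge x 0 with hx | hx
  · have e : {ω | A.indicator (fun _ => (1 : ℝ)) ω ≤ x} = ∅ := by
      refine Set.eq_empty_of_forall_notMem fun ω hω => ?_
      exact absurd (hω.out.trans_lt hx) (not_lt.2 (Set.indicator_nonneg (fun _ _ => zero_le_one) ω))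
    rw [e, measureReal_empty]
    have h0 : (0 : ℝ) ≤ (Set.Ioi (1 - P.real A)).indicator (fun _ => 1) u :=
      Set.indicator_nonneg (fun _ _ => zero_le_one) u
    exact iff_of_false (not_le.2 hu.1) (not_le.2 (hx.trans_le h0))
  rcases lt_or_ge x 1 with hx1 | hx1
  · have e : {ω | A.indicator (fun _ => (1 : ℝ)) ω ≤ x} = Aᶜ := by
      ext ω
      by_cases h : ω ∈ A <;> simp [h, hx, hx1]
    rw [e, probReal_compl_eq_one_sub hA]
    by_cases h : 1 - P.real A < u
    · rw [Set.indicator_of_mem (by exact h)]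
      exact iff_of_false (not_le.2 h) (not_le.2 hx1)
    · rw [Set.indicator_of_notMem (by exact h)]
      exact iff_of_true (not_lt.1 h) hx
  · have e : {ω | A.indicator (fun _ => (1 : ℝ)) ω ≤ x} = Set.univ := by
      refine Set.eq_univ_of_forall fun ω => ?_
      by_cases h : ω ∈ A <;> simp [h, hx, hx1]
    rw [e, probReal_univ]
    refine iff_of_true hu.2 (le_trans ?_ hx1)
    exact Set.indicator_apply_le' (fun _ => le_rfl) (fun _ => zero_le_one)

lemma abs_realVaR_le {X : Ω → ℝ} (hX : X ∈ boundedRV Ω) {C : ℝ} (hC : ∀ ω, |X ω| ≤ C) {u : ℝ}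
    (hu : u ∈ Set.Ioc (0 : ℝ) 1) : |realVaR P u X| ≤ C := by
  rw [abs_le]
  constructor
  · by_contra! hlt
    have h := (realVaR_le_iff (P := P) hX hu _).1 le_rfl
    have e : {ω | -X ω ≤ realVaR P u X} = ∅ := Set.eq_empty_of_forall_notMem fun ω hω => by
      have := (abs_le.1 (hC ω)).2
      have := hω.out
      linarith
    rw [e, measureReal_empty] at h
    exact absurd h (not_le.2 hu.1)
  · rw [realVaR_le_iff hX hu]
    have e : {ω | -X ω ≤ C} = Set.univ := Set.eq_univ_of_forall fun ω => by
      have := (abs_le.1 (hC ω)).1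
      simp only [Set.mem_ofPred_eq]
      linarith
    rw [e, probReal_univ]
    exact hu.2

end Quantile

/-! ### Spectral functionals -/

section Spectral

variable {Ω : Type*} [MeasurableSpace Ω] {P : Measure Ω} {F : StieltjesFunction ℝ}

lemma spectral_eq (p : ℝ) (F : StieltjesFunction ℝ) (X : Ω → ℝ) :
    spectral P p F X =
      p * (∫ u in Set.Ioc 0 1, realVaR P u X ∂F.measure) + (1 - p) * realVaR P 1 X := by
  rw [spectral, intervalIntegral.integral_of_le zero_le_one]
  rfl

lemma one_mem_Ioc : (1 : ℝ) ∈ Set.Ioc (0 : ℝ) 1 := ⟨one_pos, le_rfl⟩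

lemma measure_Ioc_ne_top (a b : ℝ) : F.measure (Set.Ioc a b) ≠ ⊤ := by
  rw [F.measure_Ioc]
  exact ENNReal.ofReal_ne_top

variable [IsProbabilityMeasure P]

lemma integrableOn_realVaR {X : Ω → ℝ} (hX : X ∈ boundedRV Ω) :
    IntegrableOn (fun u => realVaR P u X) (Set.Ioc 0 1) F.measure := by
  obtain ⟨C, hC⟩ := hX.2
  refine IntegrableOn.of_bound (C := C) (measure_Ioc_ne_top 0 1).lt_top
    (aemeasurable_restrict_of_monotoneOn measurableSet_Ioc
      (realVaR_mono_level hX)).aestronglyMeasurable ?_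
  filter_upwards [ae_restrict_mem measurableSet_Ioc] with u hu
  exact abs_realVaR_le hX hC hu

namespace IsContinuousConvexDF

lemma map_zero (hF : IsContinuousConvexDF F) : F 0 = 0 := by
  have h : Filter.Tendsto F (nhdsWithin 0 (Set.Iio 0)) (nhds (F 0)) :=
    hF.continuous.continuousAt.mono_left nhdsWithin_le_nhds
  refine tendsto_nhds_unique h (tendsto_const_nhds.congr' ?_)
  filter_upwards [self_mem_nhdsWithin] with u hu
  exact (hF.eq_zero u hu).symm

lemma measureReal_Ioc (hF : IsContinuousConvexDF F) {a : ℝ} (ha : a ≤ 1) :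
    F.measure.real (Set.Ioc a 1) = 1 - F a := by
  rw [Measure.real, F.measure_Ioc, ENNReal.toReal_ofReal (sub_nonneg.2 (F.mono ha)),
    hF.eq_one 1 le_rfl]

lemma isComonotoneFunctional_spectral (hF : IsContinuousConvexDF F) {p : ℝ}
    (hp : p ∈ Set.Icc (0 : ℝ) 1) : IsComonotoneFunctional (spectral P p F) where
  mono X hX Y hY h := by
    rw [spectral_eq, spectral_eq]
    refine add_le_add (mul_le_mul_of_nonneg_left ?_ hp.1)
      (mul_le_mul_of_nonneg_left (realVaR_anti hX hY h one_mem_Ioc) (sub_nonneg.2 hp.2))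
    exact setIntegral_mono_on (integrableOn_realVaR hY) (integrableOn_realVaR hX) measurableSet_Ioc
      fun u hu => realVaR_anti hX hY h hu
  hom X hX h hh := by
    rw [spectral_eq, spectral_eq, realVaR_const_mul hX hh one_mem_Ioc,
      setIntegral_congr_fun measurableSet_Ioc fun u hu => realVaR_const_mul hX hh hu,
      integral_const_mul]
    ring
  trans X hX a := by
    rw [spectral_eq, spectral_eq, realVaR_add_const hX a one_mem_Ioc,
      setIntegral_congr_fun measurableSet_Ioc fun u hu => realVaR_add_const hX a hu,
      integral_sub (integrableOn_realVaR hX) (integrableOn_const (measure_Ioc_ne_top 0 1)),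
      setIntegral_const, hF.measureReal_Ioc zero_le_one, hF.map_zero, smul_eq_mul]
    ring
  comon f g Z hf hg _ hfZ hgZ := by
    rw [spectral_eq, spectral_eq, spectral_eq, realVaR_comonotone_add hf hg hfZ hgZ one_mem_Ioc,
      setIntegral_congr_fun measurableSet_Ioc fun u hu => realVaR_comonotone_add hf hg hfZ hgZ hu,
      integral_add (integrableOn_realVaR hfZ) (integrableOn_realVaR hgZ)]
    ring

lemma spectral_unitLoss (hF : IsContinuousConvexDF F) (p : ℝ) {A : Set Ω} (hA : MeasurableSet A) :
    spectral P p F (unitLoss A) =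
      p * (1 - F (1 - P.real A)) + (1 - p) * (if 0 < P.real A then 1 else 0) := by
  have hA1 : P.real A ≤ 1 := measureReal_le_one
  rw [spectral_eq, realVaR_unitLoss hA one_mem_Ioc,
    setIntegral_congr_fun measurableSet_Ioc fun u hu => realVaR_unitLoss (P := P) hA hu,
    setIntegral_indicator measurableSet_Ioi, setIntegral_const, smul_eq_mul, mul_one,
    Set.Ioc_inter_Ioi, sup_eq_right.2 (sub_nonneg.2 hA1),
    hF.measureReal_Ioc (sub_le_self 1 measureReal_nonneg), Set.indicator_apply]
  simp

/-- For the convex `F`, `F(x) + F(y) ≤ F(s) + F(t)` when `s ≤ x, y ≤ t` and `x + y = s + t`. -/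
lemma add_le_add_of_spread (hF : IsContinuousConvexDF F) {s t x y : ℝ} (hs : 0 ≤ s) (ht : t ≤ 1)
    (hsx : s ≤ x) (hxt : x ≤ t) (hsum : x + y = s + t) : F x + F y ≤ F s + F t := by
  rcases hsx.eq_or_lt with rfl | hlt
  · rw [add_left_cancel hsum]
  have hst : 0 < t - s := by linarith
  have hsm : s ∈ Set.Icc (0 : ℝ) 1 := ⟨hs, by linarith⟩
  have htm : t ∈ Set.Icc (0 : ℝ) 1 := ⟨by linarith, ht⟩
  have ha : 0 ≤ (t - x) / (t - s) := div_nonneg (by linarith) hst.le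
  have hb : 0 ≤ (x - s) / (t - s) := div_nonneg (by linarith) hst.le
  have hab : (t - x) / (t - s) + (x - s) / (t - s) = 1 := by field_simp; ring
  have h1 := hF.convexOn.2 hsm htm ha hb hab
  have h2 := hF.convexOn.2 hsm htm hb ha (by rw [add_comm]; exact hab)
  simp only [smul_eq_mul] at h1 h2
  have e1 : (t - x) / (t - s) * s + (x - s) / (t - s) * t = x := by field_simp; ring
  have e2 : (x - s) / (t - s) * s + (t - x) / (t - s) * t = y := by
    rw [show y = s + t - x by linarith]
    field_simp
    ring
  rw [e1] at h1
  rw [e2] at h2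
  have e3 : (t - x) / (t - s) = 1 - (x - s) / (t - s) := by linarith
  rw [e3] at h1 h2
  linarith

lemma isSubmodularOnEvents_spectral (hF : IsContinuousConvexDF F) {p : ℝ}
    (hp : p ∈ Set.Icc (0 : ℝ) 1) : IsSubmodularOnEvents (spectral P p F) := by
  intro A B hA hB
  rw [hF.spectral_unitLoss p hA, hF.spectral_unitLoss p hB, hF.spectral_unitLoss p (hA.union hB),
    hF.spectral_unitLoss p (hA.inter hB)]
  have hsum := measureReal_union_add_inter (μ := P) (s := A) hB
  have hle : P.real A ≤ P.real (A ∪ B) := measureReal_mono Set.subset_union_left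
  have hle' : P.real B ≤ P.real (A ∪ B) := measureReal_mono Set.subset_union_right
  have hge : P.real (A ∩ B) ≤ P.real A := measureReal_mono Set.inter_subset_left
  have hge' : P.real (A ∩ B) ≤ P.real B := measureReal_mono Set.inter_subset_right
  have h1 : P.real (A ∪ B) ≤ 1 := measureReal_le_one
  have h0 : 0 ≤ P.real (A ∩ B) := measureReal_nonneg
  have hconv := hF.add_le_add_of_spread (s := 1 - P.real (A ∪ B)) (t := 1 - P.real (A ∩ B))
    (x := 1 - P.real A) (y := 1 - P.real B) (by linarith) (by linarith) (by linarith) (by linarith)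
    (by linarith)
  have hind : (if 0 < P.real (A ∪ B) then (1 : ℝ) else 0) + (if 0 < P.real (A ∩ B) then 1 else 0) ≤
      (if 0 < P.real A then 1 else 0) + (if 0 < P.real B then 1 else 0) := by
    split_ifs <;> linarith
  have h2 := mul_le_mul_of_nonneg_left hconv hp.1
  have h3 := mul_le_mul_of_nonneg_left hind (sub_nonneg.2 hp.2)
  linarith

end IsContinuousConvexDF

end Spectral

/-! ### Convexity from midpoint convexity, and the distribution function -/

/-- If `h` is the excess of `G` over a chord and `h ≤ M` on it, then reflecting the nearer end point
of the chord in `z` gives `h z ≤ M / 2`; hence the supremum of `h` is at most `0`. -/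
lemma convexOn_of_midpoint_of_le {G : ℝ → ℝ} {s : Set ℝ} (hs : Convex ℝ s) {B : ℝ}
    (hB : ∀ x ∈ s, G x ≤ B)
    (hmid : ∀ x ∈ s, ∀ y ∈ s, 2 * G ((x + y) / 2) ≤ G x + G y) : ConvexOn ℝ s G := by
  refine ⟨hs, fun x hx y hy a b ha hb hab => ?_⟩
  set h : ℝ → ℝ := fun t => G ((1 - t) * x + t * y) - ((1 - t) * G x + t * G y) with hh
  have hmem : ∀ t ∈ Set.Icc (0 : ℝ) 1, (1 - t) * x + t * y ∈ s := fun t ht =>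
    hs hx hy (sub_nonneg.2 ht.2) ht.1 (by ring)
  have hbdd : BddAbove (h '' Set.Icc 0 1) := by
    refine ⟨B + (|G x| + |G y|), ?_⟩
    rintro _ ⟨t, ht, rfl⟩
    have h1 := hB _ (hmem t ht)
    have h2 := neg_abs_le (G x)
    have h3 := neg_abs_le (G y)
    have h4 := abs_nonneg (G x)
    have h5 := abs_nonneg (G y)
    have h6 : -|G x| ≤ (1 - t) * G x := by nlinarith [ht.1, ht.2]
    have h7 : -|G y| ≤ t * G y := by nlinarith [ht.1, ht.2]
    simp only [hh]
    linarith
  have hhmid : ∀ u ∈ Set.Icc (0 : ℝ) 1, ∀ v ∈ Set.Icc (0 : ℝ) 1,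
      2 * h ((u + v) / 2) ≤ h u + h v := by
    intro u hu v hv
    have h1 := hmid _ (hmem u hu) _ (hmem v hv)
    have e : ((1 - u) * x + u * y + ((1 - v) * x + v * y)) / 2 =
        (1 - (u + v) / 2) * x + (u + v) / 2 * y := by ring
    rw [e] at h1
    simp only [hh]
    linarith
  have h0 : h 0 = 0 := by simp [hh]
  have h1 : h 1 = 0 := by simp [hh]
  set M := sSup (h '' Set.Icc 0 1)
  have hleM : ∀ t ∈ Set.Icc (0 : ℝ) 1, h t ≤ M := fun t ht => le_csSup hbdd ⟨t, ht, rfl⟩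
  have hhalf : ∀ t ∈ Set.Icc (0 : ℝ) 1, h t ≤ M / 2 := by
    intro t ht
    rcases le_total t (1 / 2) with hle | hle
    · have hm : 2 * t ∈ Set.Icc (0 : ℝ) 1 := ⟨by linarith [ht.1], by linarith⟩
      have := hhmid 0 ⟨le_rfl, zero_le_one⟩ (2 * t) hm
      rw [show (0 + 2 * t) / 2 = t by ring, h0] at this
      linarith [hleM _ hm]
    · have hm : 2 * t - 1 ∈ Set.Icc (0 : ℝ) 1 := ⟨by linarith, by linarith [ht.2]⟩
      have := hhmid 1 ⟨zero_le_one, le_rfl⟩ (2 * t - 1) hm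
      rw [show (1 + (2 * t - 1)) / 2 = t by ring, h1] at this
      linarith [hleM _ hm]
  have hM : M ≤ M / 2 := by
    refine csSup_le ⟨h 0, 0, ⟨le_rfl, zero_le_one⟩, rfl⟩ ?_
    rintro _ ⟨t, ht, rfl⟩
    exact hhalf t ht
  have hfin := hleM b ⟨hb, by linarith⟩
  simp only [hh, smul_eq_mul] at hfin ⊢
  rw [show a = 1 - b by linarith]
  linarith

/-- A monotone `G` that is convex on `[0, 1]`, with `G = 0` on `(-∞, 0]` and `G 1 = 1`, can only jump
at `1`. Left of `1` it is a multiple `p F` of a continuous convex distribution function `F`, the factor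
`p` being the left limit of `G` at `1`. -/
theorem exists_isContinuousConvexDF {G : ℝ → ℝ} (hG : Monotone G) (h0 : ∀ u ≤ 0, G u = 0)
    (h1 : G 1 = 1) (hconv : ConvexOn ℝ (Set.Icc 0 1) G) :
    ∃ p ∈ Set.Icc (0 : ℝ) 1, ∃ F : StieltjesFunction ℝ, IsContinuousConvexDF F ∧
      ∀ u < 1, p * F u = G u := by
  have h01 : (0 : ℝ) ∈ Set.Iio 1 := Set.mem_Iio.2 one_pos
  have hnn : ∀ u, 0 ≤ G u := fun u => by
    rcases le_total u 0 with h | h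
    · rw [h0 u h]
    · rw [← h0 0 le_rfl]; exact hG h
  have hbdd : BddAbove (G '' Set.Iio 1) := by
    refine ⟨1, ?_⟩
    rintro _ ⟨u, hu, rfl⟩
    rw [← h1]
    exact hG (le_of_lt hu)
  set p := sSup (G '' Set.Iio 1) with hp
  have hle : ∀ u < 1, G u ≤ p := fun u hu => le_csSup hbdd ⟨u, hu, rfl⟩
  have hp0 : 0 ≤ p := (hnn 0).trans (hle 0 one_pos)
  have hp1 : p ≤ 1 := by
    refine csSup_le ⟨G 0, 0, h01, rfl⟩ ?_
    rintro _ ⟨u, hu, rfl⟩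
    rw [← h1]
    exact hG (le_of_lt hu)
  rcases hp0.eq_or_lt with hpz | hpos
  · -- Here `G` vanishes left of `1` and any `F` will do; take the uniform distribution.
    have hcont : Continuous fun u : ℝ => max 0 (min 1 u) := by fun_prop
    refine ⟨0, ⟨le_rfl, zero_le_one⟩, ⟨fun u => max 0 (min 1 u),
      fun a b hab => max_le_max le_rfl (min_le_min le_rfl hab),
      fun x => hcont.continuousWithinAt⟩, ⟨hcont, fun u hu => ?_, fun u hu => ?_, ?_⟩,
      fun u hu => ?_⟩
    · exact max_eq_left ((min_le_right _ _).trans hu.le)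
    · change max 0 (min 1 u) = 1
      rw [min_eq_left hu, max_eq_right zero_le_one]
    · refine (convexOn_id (convex_Icc (0 : ℝ) 1)).congr fun u hu => ?_
      change u = max 0 (min 1 u)
      rw [min_eq_right hu.2, max_eq_right hu.1]
    · rw [zero_mul]
      exact le_antisymm (hnn u) (hpz ▸ hle u hu)
  -- `H` is `G` with the jump at `1` removed.
  set H : ℝ → ℝ := fun u => if u < 1 then G u else p with hH
  have hHlt : ∀ u < 1, H u = G u := fun u hu => if_pos hu
  have hHge : ∀ u, 1 ≤ u → H u = p := fun u hu => if_neg (not_lt.2 hu)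
  have hHle : ∀ u, H u ≤ p := fun u => by
    rcases lt_or_ge u 1 with h | h
    · rw [hHlt u h]; exact hle u h
    · rw [hHge u h]
  have hHmono : Monotone H := by
    intro a b hab
    rcases lt_or_ge b 1 with h | h
    · rw [hHlt b h, hHlt a (hab.trans_lt h)]; exact hG hab
    · rw [hHge b h]; exact hHle a
  have hHcont : Continuous H := by
    refine continuous_iff_continuousAt.2 fun u => ?_
    rcases lt_or_ge u 1 with hu | hu
    · refine ContinuousAt.congr (f := G) ?_ ?_
      · rcases lt_trichotomy u 0 with hu0 | rfl | hu0
        · refine (continuousAt_const (y := (0 : ℝ))).congr ?_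
          filter_upwards [Iio_mem_nhds hu0] with v hv
          exact (h0 v (le_of_lt hv)).symm
        · -- Convexity gives `G v ≤ v` on `[0, 1]`.
          have hup : ∀ᶠ v in nhds (0 : ℝ), G v ≤ max v 0 := by
            filter_upwards [Iio_mem_nhds one_pos] with v hv
            rcases le_total v 0 with h | h
            · rw [h0 v h]; exact le_max_right _ _
            · have hc := hconv.2 (Set.left_mem_Icc.2 zero_le_one)
                (Set.right_mem_Icc.2 zero_le_one) (sub_nonneg.2 (le_of_lt hv)) h
                (sub_add_cancel 1 v)
              simp only [smul_eq_mul, mul_zero, mul_one, zero_add, h0 0 le_rfl, h1] at hc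
              exact hc.trans (le_max_left _ _)
          rw [ContinuousAt, h0 0 le_rfl]
          refine tendsto_of_tendsto_of_tendsto_of_le_of_le' tendsto_const_nhds ?_
            (Filter.Eventually.of_forall hnn) hup
          have : Continuous fun v : ℝ => max v 0 := by fun_prop
          simpa using this.tendsto 0
        · have h := hconv.continuousOn_interior
          rw [interior_Icc] at h
          exact h.continuousAt (Ioo_mem_nhds hu0 hu)
      · filter_upwards [Iio_mem_nhds hu] with v hv
        exact (hHlt v hv).symm
    · rw [ContinuousAt, hHge u hu]
      refine tendsto_order.2 ⟨fun c hc => ?_, fun c hc =>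
        Filter.Eventually.of_forall fun v => (hHle v).trans_lt hc⟩
      obtain ⟨_, ⟨t, ht, rfl⟩, hct⟩ := exists_lt_of_lt_csSup
        (Set.nonempty_of_mem (Set.mem_image_of_mem G h01)) hc
      filter_upwards [Ioi_mem_nhds (lt_of_lt_of_le ht hu)] with v hv
      rw [← hHlt t ht] at hct
      exact hct.trans_le (hHmono (le_of_lt hv))
  have hHmid : ∀ x ∈ Set.Icc (0 : ℝ) 1, ∀ y ∈ Set.Icc (0 : ℝ) 1,
      2 * H ((x + y) / 2) ≤ H x + H y := by
    have hlt : ∀ x ∈ Set.Ico (0 : ℝ) 1, ∀ y ∈ Set.Ico (0 : ℝ) 1,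
        2 * H ((x + y) / 2) ≤ H x + H y := by
      intro x hx y hy
      have hc := hconv.2 (Set.Ico_subset_Icc_self hx) (Set.Ico_subset_Icc_self hy)
        one_half_pos.le one_half_pos.le (add_halves 1)
      simp only [smul_eq_mul] at hc
      rw [hHlt x hx.2, hHlt y hy.2, hHlt _ (by linarith [hx.2, hy.2]),
        show (x + y) / 2 = 1 / 2 * x + 1 / 2 * y by ring]
      linarith
    -- The closed square lies in the closure of the half-open one.
    intro x hx y hy
    have hclosed : IsClosed {q : ℝ × ℝ | 2 * H ((q.1 + q.2) / 2) ≤ H q.1 + H q.2} :=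
      isClosed_le (by fun_prop) (by fun_prop)
    have hsub : Set.Ico (0 : ℝ) 1 ×ˢ Set.Ico (0 : ℝ) 1 ⊆
        {q : ℝ × ℝ | 2 * H ((q.1 + q.2) / 2) ≤ H q.1 + H q.2} := fun q hq =>
      hlt q.1 hq.1 q.2 hq.2
    have hcl := closure_minimal hsub hclosed
    rw [closure_prod_eq, closure_Ico zero_ne_one] at hcl
    exact hcl (Set.mk_mem_prod hx hy)
  have hHconv : ConvexOn ℝ (Set.Icc 0 1) H :=
    convexOn_of_midpoint_of_le (convex_Icc 0 1) (fun x _ => hHle x) hHmid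
  have hFcont : Continuous fun u => p⁻¹ * H u := by fun_prop
  refine ⟨p, ⟨hp0, hp1⟩, ⟨fun u => p⁻¹ * H u,
    fun a b hab => mul_le_mul_of_nonneg_left (hHmono hab) (inv_nonneg.2 hp0),
    fun x => hFcont.continuousWithinAt⟩, ⟨hFcont, fun u hu => ?_, fun u hu => ?_, ?_⟩,
    fun u hu => ?_⟩
  · change p⁻¹ * H u = 0
    rw [hHlt u (hu.trans one_pos), h0 u hu.le, mul_zero]
  · change p⁻¹ * H u = 1
    rw [hHge u hu, inv_mul_cancel₀ hpos.ne']
  · exact hHconv.smul (inv_nonneg.2 hp0)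
  · change p * (p⁻¹ * H u) = G u
    rw [hHlt u hu, mul_inv_cancel_left₀ hpos.ne']

/-! ### Law invariant functionals and the characterization -/

section Representation

variable {Ω : Type*} [MeasurableSpace Ω] {P : Measure Ω}

lemma measureReal_uniform_Iic {U : Ω → ℝ} (hU : Measurable U)
    (hunif : pdf.IsUniform U (Set.Ioo (0 : ℝ) 1) P volume) {a : ℝ} (ha : a ∈ Set.Icc (0 : ℝ) 1) :
    P.real (U ⁻¹' Set.Iic a) = a := by
  rw [← map_measureReal_apply hU measurableSet_Iic, hunif, Measure.real,
    ProbabilityTheory.cond_apply measurableSet_Ioo, Real.volume_Ioo, sub_zero, ENNReal.ofReal_one,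
    inv_one, one_mul]
  rcases ha.2.eq_or_lt with rfl | h1
  · rw [Set.inter_eq_left.2 (Set.Ioo_subset_Iio_self.trans Set.Iio_subset_Iic_self)]
    simp
  · have e : Set.Ioo (0 : ℝ) 1 ∩ Set.Iic a = Set.Ioc 0 a := by
      ext x
      simp only [Set.mem_inter_iff, Set.mem_Ioo, Set.mem_Iic, Set.mem_Ioc]
      constructor
      · rintro ⟨⟨h2, -⟩, h3⟩; exact ⟨h2, h3⟩
      · rintro ⟨h2, h3⟩; exact ⟨⟨h2, h3.trans_lt h1⟩, h3⟩
    rw [e, Real.volume_Ioc, sub_zero, ENNReal.toReal_ofReal ha.1]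

/-- A comonotone functional is submodular on events if it is subadditive: `1_{A ∪ B}` and
`1_{A ∩ B}` are comonotone and add up to `1_A + 1_B`. -/
lemma IsComonotoneFunctional.isSubmodularOnEvents {r : (Ω → ℝ) → ℝ}
    (hr : IsComonotoneFunctional r)
    (hsub : ∀ X ∈ boundedRV Ω, ∀ Y ∈ boundedRV Ω, r (fun ω => X ω + Y ω) ≤ r X + r Y) :
    IsSubmodularOnEvents r := by
  intro A B hA hB
  set Z : Ω → ℝ := fun ω => unitLoss A ω + unitLoss B ω with hZ
  have hZmem := add_mem_boundedRV (unitLoss_mem_boundedRV hA) (unitLoss_mem_boundedRV hB)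
  have hstep : ∀ c : ℝ, Monotone fun z : ℝ => if z ≤ c then (-1 : ℝ) else 0 := by
    intro c a b h
    dsimp only
    split_ifs <;> linarith
  have e1 : unitLoss (A ∪ B) = fun ω => (fun z : ℝ => if z ≤ -1 then (-1 : ℝ) else 0) (Z ω) := by
    funext ω
    by_cases h1 : ω ∈ A <;> by_cases h2 : ω ∈ B <;> simp [hZ, unitLoss, h1, h2]
  have e2 : unitLoss (A ∩ B) = fun ω => (fun z : ℝ => if z ≤ -2 then (-1 : ℝ) else 0) (Z ω) := by
    funext ω
    by_cases h1 : ω ∈ A <;> by_cases h2 : ω ∈ B <;> norm_num [hZ, unitLoss, h1, h2]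
  have h1 := unitLoss_mem_boundedRV (hA.union hB)
  have h2 := unitLoss_mem_boundedRV (hA.inter hB)
  rw [e1] at h1
  rw [e2] at h2
  have h := hr.comon _ _ Z (hstep (-1)) (hstep (-2)) hZmem.1 h1 h2
  have e : (fun ω => (if Z ω ≤ -1 then (-1 : ℝ) else 0) + (if Z ω ≤ -2 then (-1 : ℝ) else 0)) =
      Z := by
    funext ω
    by_cases h1 : ω ∈ A <;> by_cases h2 : ω ∈ B <;> norm_num [hZ, unitLoss, h1, h2]
  rw [e1, e2, ← h, e]
  exact hsub _ (unitLoss_mem_boundedRV hA) _ (unitLoss_mem_boundedRV hB)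

/-- The value at `-1_A` depends only on the probability of `A`: law invariance on events. -/
def DependsOnProb (P : Measure Ω) (r : (Ω → ℝ) → ℝ) : Prop :=
  ∀ A B : Set Ω, MeasurableSet A → MeasurableSet B → P.real A = P.real B →
    r (unitLoss A) = r (unitLoss B)

/-- With `U` uniform and `G u = 1 - r(-1_{U ≤ 1 - u})`, submodularity says that `G` is midpoint
convex, since any `x ≤ y` in `[0, 1]` are the probabilities of the intersection and the union of two
events of probability `(x + y) / 2`. -/
theorem IsComonotoneFunctional.exists_spectral [IsProbabilityMeasure P] (hP : IsStandardNonatomic P)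
    {r : (Ω → ℝ) → ℝ}
    (hr : IsComonotoneFunctional r) (hsub : IsSubmodularOnEvents r) (hlaw : DependsOnProb P r) :
    ∃ p ∈ Set.Icc (0 : ℝ) 1, ∃ F : StieltjesFunction ℝ, IsContinuousConvexDF F ∧
      ∀ X ∈ boundedRV Ω, r X = spectral P p F X := by
  obtain ⟨U, hU, hunif⟩ := hP
  set ψ : ℝ → ℝ := fun a => r (unitLoss (U ⁻¹' Set.Iic a)) with hψ
  have hmeas : ∀ a, MeasurableSet (U ⁻¹' Set.Iic a) := fun a => hU measurableSet_Iic
  have hprob : ∀ a ∈ Set.Icc (0 : ℝ) 1, P.real (U ⁻¹' Set.Iic a) = a := fun a ha =>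
    measureReal_uniform_Iic hU hunif ha
  have hψmono : Monotone ψ := fun a b hab =>
    hr.unitLoss_mono (hmeas a) (hmeas b) (Set.preimage_mono (Set.Iic_subset_Iic.2 hab))
  have hψP : ∀ A, MeasurableSet A → r (unitLoss A) = ψ (P.real A) := fun A hA =>
    hlaw _ _ hA (hmeas _) (hprob _ ⟨measureReal_nonneg, measureReal_le_one⟩).symm
  have hψ0 : ψ 0 = 0 := by
    rw [← measureReal_empty (μ := P), ← hψP ∅ MeasurableSet.empty, hr.unitLoss_empty,
      measureReal_empty]
  have hψ1 : ψ 1 = 1 := by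
    rw [← probReal_univ (μ := P), ← hψP _ MeasurableSet.univ, hr.unitLoss_univ,
      probReal_univ]
  have hψge : ∀ a, 1 ≤ a → ψ a = 1 := by
    intro a ha
    refine le_antisymm ?_ (hψ1 ▸ hψmono ha)
    rw [← hr.unitLoss_univ]
    exact hr.unitLoss_mono (hmeas a) MeasurableSet.univ (Set.subset_univ _)
  have hψmid : ∀ x ∈ Set.Icc (0 : ℝ) 1, ∀ y ∈ Set.Icc (0 : ℝ) 1, x ≤ y →
      ψ x + ψ y ≤ 2 * ψ ((x + y) / 2) := by
    intro x hx y hy hxy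
    set m := (x + y) / 2 with hm
    have hxm : x ≤ m := by linarith
    have hmy : m ≤ y := by linarith
    have hA := hmeas m
    have hB : MeasurableSet (U ⁻¹' (Set.Iic x ∪ Set.Ioc m y)) :=
      hU (measurableSet_Iic.union measurableSet_Ioc)
    have eU : U ⁻¹' Set.Iic m ∪ U ⁻¹' (Set.Iic x ∪ Set.Ioc m y) = U ⁻¹' Set.Iic y := by
      ext ω
      simp only [Set.mem_union, Set.mem_preimage, Set.mem_Iic, Set.mem_Ioc]
      constructor
      · rintro (h | h | h)
        · exact h.trans hmy
        · exact h.trans hxy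
        · exact h.2
      · intro h
        rcases le_or_gt (U ω) m with h' | h'
        · exact Or.inl h'
        · exact Or.inr (Or.inr ⟨h', h⟩)
    have eI : U ⁻¹' Set.Iic m ∩ U ⁻¹' (Set.Iic x ∪ Set.Ioc m y) = U ⁻¹' Set.Iic x := by
      ext ω
      simp only [Set.mem_union, Set.mem_inter_iff, Set.mem_preimage, Set.mem_Iic, Set.mem_Ioc]
      constructor
      · rintro ⟨h, h' | h'⟩
        · exact h'
        · exact absurd h'.1 (not_lt.2 h)
      · intro h
        exact ⟨h.trans hxm, Or.inl h⟩
    have hPB := measureReal_union_add_inter (μ := P) (s := U ⁻¹' Set.Iic m) hB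
    rw [eU, eI, hprob x hx, hprob y hy, hprob m ⟨hx.1.trans hxm, hmy.trans hy.2⟩] at hPB
    have h := hsub _ _ hA hB
    rw [eU, eI, hψP _ hB, show P.real (U ⁻¹' (Set.Iic x ∪ Set.Ioc m y)) = m by linarith] at h
    change ψ y + ψ x ≤ ψ m + ψ m at h
    linarith
  have hGconv : ConvexOn ℝ (Set.Icc 0 1) fun u => 1 - ψ (1 - u) := by
    refine convexOn_of_midpoint_of_le (B := 1) (convex_Icc 0 1) (fun x hx => ?_) fun x hx y hy => ?_
    · have := hψmono (sub_nonneg.2 hx.2)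
      linarith
    · have hx' : 1 - x ∈ Set.Icc (0 : ℝ) 1 := ⟨by linarith [hx.2], by linarith [hx.1]⟩
      have hy' : 1 - y ∈ Set.Icc (0 : ℝ) 1 := ⟨by linarith [hy.2], by linarith [hy.1]⟩
      rw [show 1 - (x + y) / 2 = (1 - x + (1 - y)) / 2 by ring]
      rcases le_total (1 - x) (1 - y) with h | h
      · linarith [hψmid _ hx' _ hy' h]
      · rw [add_comm (1 - x)]
        linarith [hψmid _ hy' _ hx' h]
  obtain ⟨p, hp, F, hF, hpF⟩ := exists_isContinuousConvexDF (G := fun u => 1 - ψ (1 - u))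
    (fun a b hab => by have := hψmono (sub_le_sub_left hab 1); dsimp only; linarith)
    (fun u hu => by rw [hψge _ (by linarith), sub_self])
    (by rw [sub_self, hψ0, sub_zero]) hGconv
  refine ⟨p, hp, F, hF, fun X hX =>
    hr.eq_of_eq_on_events (hF.isComonotoneFunctional_spectral hp) (fun A hA => ?_) hX⟩
  rw [hψP A hA, hF.spectral_unitLoss p hA]
  rcases (measureReal_nonneg (μ := P) (s := A)).eq_or_lt with h | h
  · rw [← h, if_neg (lt_irrefl _), hψ0, sub_zero, hF.eq_one 1 le_rfl]
    ring
  · have := hpF (1 - P.real A) (by linarith)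
    rw [sub_sub_cancel] at this
    rw [if_pos h]
    linarith

/-- A coherent risk measure with one finite value is finite everywhere: every `Y` dominates
`X - a` for a suitable constant `a`. -/
lemma IsCoherent.ne_top {ρ : boundedRV Ω → WithTop ℝ} (hρ : IsCoherent ρ) (hfin : ∃ X, ρ X ≠ ⊤)
    (Y : boundedRV Ω) : ρ Y ≠ ⊤ := by
  obtain ⟨X, hX⟩ := hfin
  obtain ⟨C, hC⟩ := X.2.2
  obtain ⟨D, hD⟩ := Y.2.2
  have hmem := add_const_mem_boundedRV X.2 (-(C + D))
  have h1 := hρ.monotonous ⟨_, hmem⟩ Y fun ω => by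
    have h1 := (abs_le.1 (hC ω)).2
    have h2 := (abs_le.1 (hD ω)).1
    dsimp only
    linarith
  rw [hρ.translationInvariant X _ hmem] at h1
  exact ne_top_of_le_ne_top (WithTop.add_ne_top.2 ⟨hX, WithTop.coe_ne_top⟩) h1

open Classical in
/-- The real-valued version of `ρ`, set to `0` off `boundedRV Ω`. -/
noncomputable def toRealFunctional (ρ : boundedRV Ω → WithTop ℝ) (X : Ω → ℝ) : ℝ :=
  if hX : X ∈ boundedRV Ω then (ρ ⟨X, hX⟩).untopD 0 else 0

lemma coe_toRealFunctional {ρ : boundedRV Ω → WithTop ℝ} (hfin : ∀ X, ρ X ≠ ⊤) {X : Ω → ℝ}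
    (hX : X ∈ boundedRV Ω) : ((toRealFunctional ρ X : ℝ) : WithTop ℝ) = ρ ⟨X, hX⟩ := by
  rw [toRealFunctional, dif_pos hX]
  obtain ⟨x, hx⟩ := WithTop.ne_top_iff_exists.1 (hfin ⟨X, hX⟩)
  rw [← hx, WithTop.untopD_coe]

lemma isComonotoneFunctional_toRealFunctional {ρ : boundedRV Ω → WithTop ℝ}
    (hfin : ∀ X, ρ X ≠ ⊤) (hρ : IsCoherent ρ) (hcom : IsComonotonicAdditive ρ) :
    IsComonotoneFunctional (toRealFunctional ρ) where
  mono X hX Y hY h := by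
    rw [← WithTop.coe_le_coe, coe_toRealFunctional hfin hX, coe_toRealFunctional hfin hY]
    exact hρ.monotonous ⟨X, hX⟩ ⟨Y, hY⟩ h
  hom X hX h hh := by
    rw [← WithTop.coe_inj, WithTop.coe_mul, coe_toRealFunctional hfin hX,
      coe_toRealFunctional hfin (const_mul_mem_boundedRV hX h)]
    exact hρ.posHomogeneous ⟨X, hX⟩ h hh _
  trans X hX a := by
    rw [← WithTop.coe_inj, sub_eq_add_neg, WithTop.coe_add, coe_toRealFunctional hfin hX,
      coe_toRealFunctional hfin (add_const_mem_boundedRV hX a)]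
    exact hρ.translationInvariant ⟨X, hX⟩ a _
  comon f g Z hf hg hZ hfZ hgZ := by
    rw [← WithTop.coe_inj, WithTop.coe_add, coe_toRealFunctional hfin hfZ,
      coe_toRealFunctional hfin hgZ, coe_toRealFunctional hfin (add_mem_boundedRV hfZ hgZ)]
    exact hcom f g Z hf hg hZ hfZ hgZ _

lemma dependsOnProb_toRealFunctional [IsProbabilityMeasure P] {ρ : boundedRV Ω → WithTop ℝ}
    (hlaw : IsLawInvariant P ρ) :
    DependsOnProb P (toRealFunctional ρ) := by
  intro A B hA hB hAB
  have hPAB : P A = P B := (measureReal_eq_measureReal_iff).1 hAB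
  rw [toRealFunctional, toRealFunctional, dif_pos (unitLoss_mem_boundedRV hA), dif_pos
    (unitLoss_mem_boundedRV hB)]
  congr 1
  refine hlaw _ _ fun t => ?_
  have hset : ∀ D : Set Ω, {ω | unitLoss D ω ≤ t} =
      if 0 ≤ t then Set.univ else if -1 ≤ t then D else ∅ := by
    intro D
    ext ω
    split_ifs with h1 h2 <;> by_cases hω : ω ∈ D <;> simp [unitLoss, hω] <;> linarith
  simp only [hset]
  split_ifs <;> simp [hPAB]

end Representation

end RiskMeasure

open RiskMeasure in
theorem theorem1 {Ω : Type*} [MeasurableSpace Ω] (P : MeasureTheory.Measure Ω)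
    [MeasureTheory.IsProbabilityMeasure P] (hP : RiskMeasure.IsStandardNonatomic P)
    (ρ : RiskMeasure.boundedRV Ω → WithTop ℝ) (hρ : ∃ X, ρ X ≠ ⊤) :
    (RiskMeasure.IsCoherent ρ ∧ RiskMeasure.IsLawInvariant P ρ ∧
        RiskMeasure.IsComonotonicAdditive ρ) ↔
      ∃ p ∈ Set.Icc (0 : ℝ) 1, ∃ F : StieltjesFunction ℝ, RiskMeasure.IsContinuousConvexDF F ∧
        ∀ X : RiskMeasure.boundedRV Ω,
          ρ X = ((RiskMeasure.spectral P p F (X : Ω → ℝ) : ℝ) : WithTop ℝ) := by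
  constructor
  · rintro ⟨hcoh, hlaw, hcom⟩
    have hfin := hcoh.ne_top hρ
    have hr := isComonotoneFunctional_toRealFunctional hfin hcoh hcom
    have hsub : IsSubmodularOnEvents (toRealFunctional ρ) :=
      hr.isSubmodularOnEvents fun X hX Y hY => by
        rw [← WithTop.coe_le_coe, WithTop.coe_add, coe_toRealFunctional hfin hX,
          coe_toRealFunctional hfin hY, coe_toRealFunctional hfin (add_mem_boundedRV hX hY)]
        exact hcoh.subadditive ⟨X, hX⟩ ⟨Y, hY⟩ _
    obtain ⟨p, hp, F, hF, h⟩ := hr.exists_spectral hP hsub (dependsOnProb_toRealFunctional hlaw)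
    exact ⟨p, hp, F, hF, fun X => by rw [← h X X.2, coe_toRealFunctional hfin X.2]⟩
  · rintro ⟨p, hp, F, hF, h⟩
    have hr := hF.isComonotoneFunctional_spectral (P := P) hp
    have hsub := hF.isSubmodularOnEvents_spectral (P := P) hp
    refine ⟨⟨fun X Y hXY => ?_, fun X a ha hX => ?_, fun X a hX => ?_, fun X Y hXY => ?_⟩,
      fun X Y hXY => ?_, fun f g Z hf hg hZ hfZ hgZ hfg => ?_⟩
    · rw [h, h, WithTop.coe_le_coe]
      exact hr.mono _ X.2 _ Y.2 hXY
    · rw [h, h, ← WithTop.coe_mul, WithTop.coe_inj]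
      exact hr.hom _ X.2 a ha
    · rw [h, h, ← WithTop.coe_add, WithTop.coe_inj, ← sub_eq_add_neg]
      exact hr.trans _ X.2 a
    · rw [h, h, h, ← WithTop.coe_add, WithTop.coe_le_coe]
      exact hr.subadditive hsub X.2 Y.2
    · rw [h, h, spectral_eq, spectral_eq]
      simp only [realVaR_congr_law X.2.1 Y.2.1 hXY]
    · rw [h, h, h, ← WithTop.coe_add, WithTop.coe_inj]
      exact hr.comon f g Z hf hg hZ hfZ hgZ
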